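/- All topological spaces are Hausdorff. A \emph{Clifford semigroup} is a semigroup $S$ in which every $x$ has a unique element $x^{-1}$ with $xx^{-1}x=x$ and $x^{-1}xx^{-1}=x^{-1}$, and in which $xx^{-1}=x^{-1}x$ for all $x$; it is a \emph{topological Clifford semigroup} if it carries a (Hausdorff) topology for which multiplication and inversion are continuous. Let $E=\{e\in S: ee=e\}$ be its maximal semilattice (with the subspace topology), $\pi:S\to E$, $\pi(x)=xx^{-1}$, and, for $e\in E$, let $H_e=\{x\in S: xx^{-1}=e=x^{-1}x\}$ be the maximal subgroup containing $e$ (with the subspace topology). For $x,y\in E$ write $x\le y$ if $xy=x=yx$, put ${\uparrow}x=\{y\in E:x\le y\}$, and write $x\ll y$ if $y$ lies in the interior of ${\uparrow}x$ in $E$. $E$ is a \emph{$U$-semilattice} if for every open $U\subset E$ and every $x\in U$ there is $y\in U$ with $y\ll x$. A set $A\subset E$ is \emph{$U$-dense} in $E$ if for every $x\in E$ and every neighborhood $O_x\subset E$ of $x$ there is $e\in O_x\cap A$ with $e\ll x$. $S$ is a \emph{topological Clifford $U$-semigroup} if $E$ is a $U$-semilattice. $S$ is \emph{ditopological} if for every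 $x\in S$ and every neighborhood $O_x$ of $x$ in $S$ there are a neighborhood $U_x$ of $x$ in $S$ and a neighborhood $W$ of $\pi(x)$ in $E$ such that every $y\in S$ with $\pi(y)\in W$ and $ya\in U_x$ for some $a\in W$ belongs to $O_x$. A metric $d$ on a Clifford semigroup is \emph{left subinvariant} if $d(zx,zy)\le d(x,y)$ for all $x,y,z$, and \emph{subinvariant} if $\max\{d(zx,zy),d(xz,yz)\}\le d(x,y)=d(x^{-1},y^{-1})$ for all $x,y,z$. A topological Clifford semigroup is \emph{metrizable} (by a metric of a given kind) if its topology is generated by some metric (of that kind). A topological group $G$ with unit $1$ is \emph{balanced} if every neighborhood $U$ of $1$ contains a neighborhood $V$ of $1$ with $xVx^{-1}=V$ for all $x\in G$. \textbf{Theorem.} Let $S$ be a ditopological topological Clifford $U$-semigroup and let $A\subset E$ be a countable set that is $U$-dense in $E$. Then $S$ is \begin{enumerate} \item metrizable if and only if $E$ is metrizable and all groups $H_e$, $e\in A$, are first countable; \item metrizable by a left subinvariant metric if and only if $E$ is metrizable by a subinvariant metric and all groups $H_e$, $e\in A$, are first countable; \item metrizable by a subinvariant metric if and only if $E$ is metrizable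 by a subinvariant metric and all groups $H_e$, $e\in A$, are first countable and balanced. \end{enumerate} -/

import Mathlib

open Topology

/-- A Clifford semigroup: every `x` has a unique inverse `x⁻¹`, i.e. a unique `y` with
`x * y * x = x` and `y * x * y = y`, and `x` commutes with `x⁻¹`. -/
class CliffordSemigroup (S : Type*) extends Semigroup S, Inv S where
  mul_inv_mul_self : ∀ x : S, x * x⁻¹ * x = x
  inv_mul_inv_self : ∀ x : S, x⁻¹ * x * x⁻¹ = x⁻¹
  eq_inv_of_mul : ∀ x y : S, x * y * x = x → y * x * y = y → y = x⁻¹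
  mul_inv_comm : ∀ x : S, x * x⁻¹ = x⁻¹ * x

namespace CliffordSemigroup

section Algebra

variable {S : Type*} [CliffordSemigroup S]

theorem inv_eq_of_idem {e : S} (he : e * e = e) : e⁻¹ = e :=
  (eq_inv_of_mul e e (by rw [he, he]) (by rw [he, he])).symm

theorem idem_mul {e f : S} (he : e * e = e) (hf : f * f = f) :
    (e * f) * (e * f) = e * f := by
  have h1 := mul_inv_mul_self (e * f)
  have h2 := inv_mul_inv_self (e * f)
  have hx : f * (e * f)⁻¹ * e = (e * f)⁻¹ := by
    apply eq_inv_of_mul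
    · calc e * f * (f * (e * f)⁻¹ * e) * (e * f)
          = e * (f * f) * (e * f)⁻¹ * ((e * e) * f) := by simp only [mul_assoc]
        _ = e * f := by rw [he, hf, h1]
    · calc f * (e * f)⁻¹ * e * (e * f) * (f * (e * f)⁻¹ * e)
          = f * ((e * f)⁻¹ * ((e * e) * (f * f)) * (e * f)⁻¹) * e := by simp only [mul_assoc]
        _ = f * (e * f)⁻¹ * e := by rw [he, hf, h2]
  have hxx : (e * f)⁻¹ * (e * f)⁻¹ = (e * f)⁻¹ := by
    calc (e * f)⁻¹ * (e * f)⁻¹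
        = (f * (e * f)⁻¹ * e) * (f * (e * f)⁻¹ * e) := by rw [hx]
      _ = f * ((e * f)⁻¹ * (e * f) * (e * f)⁻¹) * e := by simp only [mul_assoc]
      _ = (e * f)⁻¹ := by rw [h2, hx]
  have hef : e * f = (e * f)⁻¹ := by
    have h3 := eq_inv_of_mul _ _ h2 h1
    rwa [inv_eq_of_idem hxx] at h3
  rw [hef]
  exact hxx

theorem mul_inv_idem (x : S) : (x * x⁻¹) * (x * x⁻¹) = x * x⁻¹ := by
  rw [← mul_assoc, mul_inv_mul_self]

end Algebra

/-- The maximal semilattice `E = {e : e * e = e}` of a Clifford semigroup. -/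
def maximalSemilattice (S : Type*) [CliffordSemigroup S] : Subsemigroup S where
  carrier := {e | e * e = e}
  mul_mem' ha hb := idem_mul ha hb

/-- `E` is itself a Clifford semigroup, with the operations restricted from `S`. -/
instance (S : Type*) [CliffordSemigroup S] : CliffordSemigroup (maximalSemilattice S) where
  inv e := ⟨(e : S)⁻¹, by
    have he : (e : S) * e = e := e.2
    change (e : S)⁻¹ * (e : S)⁻¹ = (e : S)⁻¹
    rw [inv_eq_of_idem he, he]⟩
  mul_inv_mul_self x := Subtype.ext (mul_inv_mul_self (x : S))
  inv_mul_inv_self x := Subtype.ext (inv_mul_inv_self (x : S))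
  eq_inv_of_mul x y h1 h2 := Subtype.ext
    (eq_inv_of_mul (x : S) y (congrArg Subtype.val h1) (congrArg Subtype.val h2))
  mul_inv_comm x := Subtype.ext (mul_inv_comm (x : S))

/-- The projection `π : S → E`, `π x = x * x⁻¹`. -/
def proj {S : Type*} [CliffordSemigroup S] (x : S) : maximalSemilattice S :=
  ⟨x * x⁻¹, mul_inv_idem x⟩

/-- The maximal subgroup `H_e = {x : x * x⁻¹ = e = x⁻¹ * x}` containing the idempotent `e`. -/
def maximalSubgroup {S : Type*} [CliffordSemigroup S] (e : maximalSemilattice S) :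
    Subsemigroup S where
  carrier := {x | x * x⁻¹ = e ∧ x⁻¹ * x = e}
  mul_mem' := by
    rintro x y ⟨hx1, hx2⟩ ⟨hy1, hy2⟩
    have hxe : x * (e : S) = x := by rw [← hx2, ← mul_assoc, mul_inv_mul_self]
    have hye : y⁻¹ * (e : S) = y⁻¹ := by rw [← hy1, ← mul_assoc, inv_mul_inv_self]
    have hey : (e : S) * y = y := by rw [← hy1, mul_inv_mul_self]
    have hex : (e : S) * x⁻¹ = x⁻¹ := by rw [← hx2, inv_mul_inv_self]
    have e1 : x * y * (y⁻¹ * x⁻¹) = e := by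
      rw [mul_assoc, ← mul_assoc y, hy1, hex, hx1]
    have e2 : y⁻¹ * x⁻¹ * (x * y) = e := by
      rw [mul_assoc, ← mul_assoc x⁻¹, hx2, hey, hy2]
    have hinv : y⁻¹ * x⁻¹ = (x * y)⁻¹ := by
      apply eq_inv_of_mul
      · rw [e1, ← mul_assoc, ← hx1, mul_inv_mul_self]
      · rw [e2, ← mul_assoc, ← hy2, inv_mul_inv_self]
    change x * y * (x * y)⁻¹ = e ∧ (x * y)⁻¹ * (x * y) = e
    rw [← hinv]
    exact ⟨e1, e2⟩

/-- `H_e` is a group with unit `e`, with the multiplication and inversion of `S`. -/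
instance {S : Type*} [CliffordSemigroup S] (e : maximalSemilattice S) :
    Group (maximalSubgroup e) where
  one := ⟨e, by
    have he : (e : S) * e = e := e.2
    change (e : S) * (e : S)⁻¹ = e ∧ (e : S)⁻¹ * e = e
    rw [inv_eq_of_idem he]
    exact ⟨he, he⟩⟩
  inv x := ⟨(x : S)⁻¹, by
    have hx : (x : S)⁻¹⁻¹ = x :=
      (eq_inv_of_mul _ _ (inv_mul_inv_self (x : S)) (mul_inv_mul_self (x : S))).symm
    change (x : S)⁻¹ * (x : S)⁻¹⁻¹ = e ∧ (x : S)⁻¹⁻¹ * (x : S)⁻¹ = e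
    rw [hx]
    exact ⟨x.2.2, x.2.1⟩⟩
  one_mul x := Subtype.ext (by
    change (e : S) * x = x
    rw [← x.2.1, mul_inv_mul_self])
  mul_one x := Subtype.ext (by
    change (x : S) * e = x
    rw [← x.2.2, ← mul_assoc, mul_inv_mul_self])
  inv_mul_cancel x := Subtype.ext x.2.2

end CliffordSemigroup

section Semilattice

variable {E : Type*} [Mul E]

/-- The upper cone `↑x = {y : x ≤ y}`, where `x ≤ y` means `x * y = x = y * x`. -/
def upperCone (x : E) : Set E := {y | x * y = x ∧ y * x = x}

/-- `x ≪ y` means that `y` lies in the interior of the upper cone of `x`. -/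
def WayBelow [TopologicalSpace E] (x y : E) : Prop := y ∈ interior (upperCone x)

/-- `A` is `U`-dense: every neighborhood of every `x` contains some `e ∈ A` with `e ≪ x`. -/
def IsUDense [TopologicalSpace E] (A : Set E) : Prop :=
  ∀ x : E, ∀ O ∈ 𝓝 x, ∃ e ∈ O ∩ A, WayBelow e x

/-- The defining condition of a `U`-semilattice. -/
def IsUSemilattice (E : Type*) [Mul E] [TopologicalSpace E] : Prop :=
  ∀ U : Set E, IsOpen U → ∀ x ∈ U, ∃ y ∈ U, WayBelow y x

end Semilattice

/-- Right division `B ÷ A = {x : ∃ b ∈ B, ∃ a ∈ A, b = x * a}`. -/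
def rightDivision {S : Type*} [Mul S] (B A : Set S) : Set S :=
  {x | ∃ b ∈ B, ∃ a ∈ A, b = x * a}

/-- Every neighborhood `O` of every `x` contains `(U ÷ W) ∩ π⁻¹(W)` for some neighborhoods
`U` of `x` in `S` and `W` of `π x` in `E`. -/
def IsDitopological (S : Type*) [CliffordSemigroup S] [TopologicalSpace S] : Prop :=
  ∀ x : S, ∀ O ∈ 𝓝 x, ∃ U ∈ 𝓝 x, ∃ W ∈ 𝓝 (CliffordSemigroup.proj x),
    rightDivision U (Subtype.val '' W) ∩ CliffordSemigroup.proj ⁻¹' W ⊆ O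

/-- A topological group is balanced if every neighborhood of the unit contains a neighborhood
of the unit that is invariant under conjugation. -/
def IsBalancedGroup (G : Type*) [Group G] [TopologicalSpace G] : Prop :=
  ∀ U ∈ 𝓝 (1 : G), ∃ V ∈ 𝓝 (1 : G), V ⊆ U ∧ ∀ x : G, (fun v => x * v * x⁻¹) '' V = V

/-- The topology of `S` is generated by a metric `d` with `d (z x) (z y) ≤ d x y`. -/
def LeftSubinvariantMetrizable (S : Type*) [CliffordSemigroup S] [t : TopologicalSpace S] :
    Prop :=
  ∃ m : MetricSpace S, m.toUniformSpace.toTopologicalSpace = t ∧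
    ∀ x y z : S, m.dist (z * x) (z * y) ≤ m.dist x y

/-- The topology of `S` is generated by a metric `d` with
`max (d (z x) (z y)) (d (x z) (y z)) ≤ d x y = d x⁻¹ y⁻¹`. -/
def SubinvariantMetrizable (S : Type*) [CliffordSemigroup S] [t : TopologicalSpace S] : Prop :=
  ∃ m : MetricSpace S, m.toUniformSpace.toTopologicalSpace = t ∧
    ∀ x y z : S, max (m.dist (z * x) (z * y)) (m.dist (x * z) (y * z)) ≤ m.dist x y ∧
      m.dist x y = m.dist x⁻¹ y⁻¹

/-!
The sets `{y | π y ∈ W, y * e ∈ V}` with `e ∈ A`, `W ⊆ E` a neighbourhood of `π x` inside `↑e` and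
`V ⊆ H_e` open form a neighbourhood base at `x`. This is the only use of ditopologicality:
`U`-density yields `e ∈ A` with `e ≪ π x` so close to `π x` that `x * e` is close to `x`
(`CliffordSemigroup.exists_nhds_of_isDitopological`). Hence the topology of `S` is determined by
`π` and by the countably many partial maps `x ↦ x * e` into the groups `H_e`, `e ∈ A`.

Given a metric on `E` and left invariant metrics `ρ_e` on the groups `H_e`, let `λ_e` be the
distance in `E` to the complement of the interior of `↑e`, capped at `1`. The cone pseudometric
`min (d (π x) (π y) + ρ_e (x * e) (y * e)) (λ_e (π x) + λ_e (π y))` collapses the region where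
`x * e` is not controlled to one point. Adding to `d (π x) (π y)` the sum of these
pseudometrics with geometric weights gives a metric generating the topology of `S`
(`gluedPseudoMetric_toTopologicalSpace`).

The shape of the cone pseudometric is chosen so that it inherits subinvariance. Idempotents of a
Clifford semigroup are central (`CliffordSemigroup.idem_central`), so `π` is a homomorphism and
`z * x * e = (z * e) * (x * e)` whenever `e ≤ π (z * x)`. A translation of `S` therefore covers a
translation of `E`, which is nonexpanding and does not increase `λ_e`
(`cappedInfDist_map_le`), and it acts on `H_e` as a translation of the group where `λ_e` is
positive; where `λ_e` vanishes, the Lipschitz property of `λ_e` gives the estimate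
(`coneDist_map_le`).

Left invariant metrics on first countable groups, and two-sided invariant ones on balanced first
countable groups, come from a metric for the left uniformity: its translates form an
equicontinuous family, so the supremum of its truncation over them generates the same topology
(`exists_pseudoMetric_nonexpanding`). In the converse directions metrics are restricted to `E` and
to the groups `H_e`.
-/

/-! ### Capped distance to a set -/

section Cutoff

variable {F : Type*} [PseudoMetricSpace F]

/-- The distance to `C` capped at `1`, with the constant value `1` when `C` is empty. -/
noncomputable def cappedInfDist (C : Set F) (x : F) : ℝ :=
  sInf (insert 1 (dist x '' C))

theorem le_cappedInfDist_iff {C : Set F} {x : F} {c : ℝ} :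
    c ≤ cappedInfDist C x ↔ c ≤ 1 ∧ ∀ y ∈ C, c ≤ dist x y := by
  rw [cappedInfDist, le_csInf_iff _ (Set.insert_nonempty _ _)]
  · simp
  · refine ⟨0, ?_⟩
    rintro b (rfl | ⟨y, -, rfl⟩)
    exacts [zero_le_one, dist_nonneg]

theorem cappedInfDist_nonneg (C : Set F) (x : F) : 0 ≤ cappedInfDist C x :=
  le_cappedInfDist_iff.2 ⟨zero_le_one, fun _ _ => dist_nonneg⟩

theorem cappedInfDist_le_one (C : Set F) (x : F) : cappedInfDist C x ≤ 1 :=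
  (le_cappedInfDist_iff.1 le_rfl).1

theorem cappedInfDist_le_dist {C : Set F} (x : F) {y : F} (hy : y ∈ C) :
    cappedInfDist C x ≤ dist x y :=
  (le_cappedInfDist_iff.1 le_rfl).2 y hy

theorem cappedInfDist_le_add (C : Set F) (x y : F) :
    cappedInfDist C x ≤ cappedInfDist C y + dist x y := by
  rw [← sub_le_iff_le_add]
  refine le_cappedInfDist_iff.2 ⟨?_, fun z hz => ?_⟩
  · linarith [cappedInfDist_le_one C x, @dist_nonneg _ _ x y]
  · linarith [cappedInfDist_le_dist x hz, dist_triangle x y z]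

theorem cappedInfDist_compl_pos_iff {T : Set F} (hT : IsOpen T) {x : F} :
    0 < cappedInfDist Tᶜ x ↔ x ∈ T := by
  refine ⟨fun h => ?_, fun hx => ?_⟩
  · by_contra hx
    have := cappedInfDist_le_dist x (C := Tᶜ) hx
    rw [dist_self] at this
    exact h.not_ge this
  · obtain ⟨ε, hε, hball⟩ := Metric.isOpen_iff.1 hT x hx
    refine (lt_min one_pos hε).trans_le (le_cappedInfDist_iff.2 ⟨min_le_left _ _, fun y hy => ?_⟩)
    by_contra! hlt
    exact hy (hball (by rw [Metric.mem_ball']; exact hlt.trans_le (min_le_right _ _)))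

/-- A nonexpanding map `f` that keeps the complement of `T` inside itself does not increase the
capped distance to that complement. -/
theorem cappedInfDist_map_le {C : Set F} {f : F → F} (hf : ∀ x y, dist (f x) (f y) ≤ dist x y)
    (hC : Set.MapsTo f C C) (x : F) : cappedInfDist C (f x) ≤ cappedInfDist C x :=
  le_cappedInfDist_iff.2 ⟨cappedInfDist_le_one _ _, fun y hy =>
    (cappedInfDist_le_dist _ (hC hy)).trans (hf x y)⟩

end Cutoff

/-! ### Cone pseudometrics -/

section ConeDist

variable {X F G : Type*} [PseudoMetricSpace F] [PseudoMetricSpace G]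

/-- The pseudometric `(x, y) ↦ dist (π x) (π y) + dist (r x) (r y)` after the zero set of the
weight `w ∘ π` has been collapsed to a point from which `x` has distance `w (π x)`. -/
noncomputable def coneDist (π : X → F) (r : X → G) (w : F → ℝ) (x y : X) : ℝ :=
  min (dist (π x) (π y) + dist (r x) (r y)) (w (π x) + w (π y))

variable {π : X → F} {r : X → G} {w : F → ℝ}

theorem coneDist_nonneg (h0 : ∀ a, 0 ≤ w a) (x y : X) : 0 ≤ coneDist π r w x y :=
  le_min (by positivity) (add_nonneg (h0 _) (h0 _))

theorem coneDist_le_two (h1 : ∀ a, w a ≤ 1) (x y : X) : coneDist π r w x y ≤ 2 :=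
  (min_le_right _ _).trans (by linarith [h1 (π x), h1 (π y)])

theorem coneDist_self (h0 : ∀ a, 0 ≤ w a) (x : X) : coneDist π r w x x = 0 := by
  simp [coneDist, h0]

theorem coneDist_comm (x y : X) : coneDist π r w x y = coneDist π r w y x := by
  simp only [coneDist, dist_comm, add_comm]

theorem coneDist_triangle (h0 : ∀ a, 0 ≤ w a) (hw : ∀ a b, w a ≤ w b + dist a b) (x y z : X) :
    coneDist π r w x z ≤ coneDist π r w x y + coneDist π r w y z := by
  have h1 := dist_triangle (π x) (π y) (π z)
  have h2 := dist_triangle (r x) (r y) (r z)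
  have h3 := hw (π x) (π y)
  have h4 := hw (π z) (π y)
  rw [dist_comm] at h4
  have h5 := h0 (π y)
  have h6 := @dist_nonneg _ _ (r x) (r y)
  have h7 := @dist_nonneg _ _ (r y) (r z)
  unfold coneDist
  rcases min_choice (dist (π x) (π y) + dist (r x) (r y)) (w (π x) + w (π y)) with h | h <;>
  rcases min_choice (dist (π y) (π z) + dist (r y) (r z)) (w (π y) + w (π z)) with h' | h' <;>
  rw [h, h'] <;>
  first
  | exact (min_le_left _ _).trans (by linarith)
  | exact (min_le_right _ _).trans (by linarith)

/-- The cone pseudometric is not increased by a map `φ` over a nonexpanding map of `F` which does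
not increase the weight and is nonexpanding in the fibre direction where the weight is positive. -/
theorem coneDist_map_le (h0 : ∀ a, 0 ≤ w a) (hw : ∀ a b, w a ≤ w b + dist a b) {φ : X → X}
    (hπ : ∀ x y, dist (π (φ x)) (π (φ y)) ≤ dist (π x) (π y))
    (hφw : ∀ x, w (π (φ x)) ≤ w (π x))
    (hr : ∀ x y, 0 < w (π (φ x)) → 0 < w (π (φ y)) → dist (r (φ x)) (r (φ y)) ≤ dist (r x) (r y))
    (x y : X) : coneDist π r w (φ x) (φ y) ≤ coneDist π r w x y := by
  refine le_min ?_ ((min_le_right _ _).trans (add_le_add (hφw x) (hφw y)))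
  rcases (h0 (π (φ x))).eq_or_lt with hx | hx
  · refine (min_le_right _ _).trans ?_
    have := hw (π (φ y)) (π (φ x))
    rw [dist_comm] at this
    linarith [hπ x y, @dist_nonneg _ _ (r x) (r y)]
  rcases (h0 (π (φ y))).eq_or_lt with hy | hy
  · refine (min_le_right _ _).trans ?_
    linarith [hw (π (φ x)) (π (φ y)), hπ x y, @dist_nonneg _ _ (r x) (r y)]
  exact (min_le_left _ _).trans (add_le_add (hπ x y) (hr x y hx hy))

theorem tendsto_coneDist [TopologicalSpace X] (hπ : Continuous π) (hwc : Continuous w)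
    (h0 : ∀ a, 0 ≤ w a) {x : X}
    (hr : 0 < w (π x) → ContinuousAt r x) :
    Filter.Tendsto (coneDist π r w x) (𝓝 x) (𝓝 0) := by
  rcases (h0 (π x)).eq_or_lt with hx | hx
  · have : Filter.Tendsto (fun y => w (π x) + w (π y)) (𝓝 x) (𝓝 (w (π x) + w (π x))) :=
      (continuous_const.add (hwc.comp hπ)).continuousAt
    rw [← hx, add_zero] at this
    refine squeeze_zero (coneDist_nonneg h0 x) (fun y => ?_) this
    rw [hx]
    exact min_le_right _ _
  · have h1 : Filter.Tendsto (fun y => dist (π x) (π y) + dist (r x) (r y)) (𝓝 x)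
        (𝓝 (dist (π x) (π x) + dist (r x) (r x))) :=
      (continuousAt_const.dist hπ.continuousAt).add (continuousAt_const.dist (hr hx))
    rw [dist_self, dist_self, add_zero] at h1
    exact squeeze_zero (coneDist_nonneg h0 x) (fun y => min_le_left _ _) h1

end ConeDist

/-! ### Gluing countably many cone pseudometrics -/

section GluedDist

variable {X F ι : Type*} {G : ι → Type*} [PseudoMetricSpace F] [∀ i, PseudoMetricSpace (G i)]
  [Encodable ι]

/-- The distance in the base plus the sum of countably many cone pseudometrics, with weights
decreasing geometrically. -/
noncomputable def gluedDist (π : X → F) (r : ∀ i, X → G i) (w : ι → F → ℝ) (x y : X) : ℝ :=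
  dist (π x) (π y) + ∑' i, (1 / 2) ^ Encodable.encode i * coneDist π (r i) (w i) x y

variable {π : X → F} {r : ∀ i, X → G i} {w : ι → F → ℝ}

theorem summable_gluedDist (h0 : ∀ i a, 0 ≤ w i a) (h1 : ∀ i a, w i a ≤ 1) (x y : X) :
    Summable fun i => (1 / 2 : ℝ) ^ Encodable.encode i * coneDist π (r i) (w i) x y :=
  Summable.of_nonneg_of_le
    (fun i => mul_nonneg (by positivity) (coneDist_nonneg (h0 i) x y))
    (fun i => mul_le_mul_of_nonneg_left (coneDist_le_two (h1 i) x y) (by positivity))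
    (summable_geometric_two_encode.mul_right 2)

theorem gluedDist_map_le (h0 : ∀ i a, 0 ≤ w i a) (h1 : ∀ i a, w i a ≤ 1)
    (hw : ∀ i a b, w i a ≤ w i b + dist a b) {φ : X → X}
    (hπ : ∀ x y, dist (π (φ x)) (π (φ y)) ≤ dist (π x) (π y))
    (hφw : ∀ i x, w i (π (φ x)) ≤ w i (π x))
    (hr : ∀ i x y, 0 < w i (π (φ x)) → 0 < w i (π (φ y)) →
      dist (r i (φ x)) (r i (φ y)) ≤ dist (r i x) (r i y))
    (x y : X) : gluedDist π r w (φ x) (φ y) ≤ gluedDist π r w x y := by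
  refine add_le_add (hπ x y) ((summable_gluedDist h0 h1 _ _).tsum_le_tsum (fun i => ?_)
    (summable_gluedDist h0 h1 _ _))
  exact mul_le_mul_of_nonneg_left (coneDist_map_le (h0 i) (hw i) hπ (hφw i) (hr i) x y)
    (by positivity)

/-- The glued distance as a pseudometric; the hypotheses say that every weight is `1`-Lipschitz
with values in `[0, 1]`. -/
noncomputable abbrev gluedPseudoMetric (π : X → F) (r : ∀ i, X → G i) (w : ι → F → ℝ)
    (h0 : ∀ i a, 0 ≤ w i a) (h1 : ∀ i a, w i a ≤ 1)
    (hw : ∀ i a b, w i a ≤ w i b + dist a b) : PseudoMetricSpace X where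
  dist := gluedDist π r w
  dist_self x := by simp [gluedDist, coneDist_self (h0 _)]
  dist_comm x y := by simp only [gluedDist, dist_comm, coneDist_comm]
  dist_triangle x y z := by
    have h : ∑' i, (1 / 2 : ℝ) ^ Encodable.encode i * coneDist π (r i) (w i) x z ≤
        ∑' i, (1 / 2 : ℝ) ^ Encodable.encode i * coneDist π (r i) (w i) x y +
        ∑' i, (1 / 2 : ℝ) ^ Encodable.encode i * coneDist π (r i) (w i) y z := by
      rw [← (summable_gluedDist h0 h1 x y).tsum_add (summable_gluedDist h0 h1 y z)]
      refine (summable_gluedDist h0 h1 x z).tsum_le_tsum (fun i => ?_)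
        ((summable_gluedDist h0 h1 x y).add (summable_gluedDist h0 h1 y z))
      rw [← mul_add]
      exact mul_le_mul_of_nonneg_left (coneDist_triangle (h0 i) (hw i) x y z) (by positivity)
    unfold gluedDist
    linarith [dist_triangle (π x) (π y) (π z)]

theorem tendsto_gluedDist [TopologicalSpace X] (hπ : Continuous π)
    (h0 : ∀ i a, 0 ≤ w i a) (h1 : ∀ i a, w i a ≤ 1) (hwc : ∀ i, Continuous (w i))
    (hr : ∀ i x, 0 < w i (π x) → ContinuousAt (r i) x) (x : X) :
    Filter.Tendsto (gluedDist π r w x) (𝓝 x) (𝓝 0) := by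
  have h2 : Filter.Tendsto (fun y => dist (π x) (π y)) (𝓝 x) (𝓝 0) := by
    simpa using (continuousAt_const.dist hπ.continuousAt : ContinuousAt (fun y => dist (π x) (π y)) x)
  have h3 : Filter.Tendsto
      (fun y => ∑' i, (1 / 2 : ℝ) ^ Encodable.encode i * coneDist π (r i) (w i) x y) (𝓝 x)
      (𝓝 (∑' _ : ι, 0)) := by
    refine tendsto_tsum_of_dominated_convergence
      ((summable_geometric_two_encode (ι := ι)).mul_right 2) (fun i => ?_)
      (Filter.Eventually.of_forall fun y i => ?_)
    · simpa using (tendsto_coneDist hπ (hwc i) (h0 i) (hr i x)).const_mul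
        ((1 / 2 : ℝ) ^ Encodable.encode i)
    · rw [Real.norm_of_nonneg (mul_nonneg (by positivity) (coneDist_nonneg (h0 i) x y))]
      exact mul_le_mul_of_nonneg_left (coneDist_le_two (h1 i) x y) (by positivity)
  have h := h2.add h3
  rw [tsum_zero, add_zero] at h
  exact h

/-- The glued pseudometric generates the topology of `X` as soon as neighbourhoods of each point
`x` are controlled by the base and by one of the maps `r i` that is continuous at `x`. -/
theorem gluedPseudoMetric_toTopologicalSpace [t : TopologicalSpace X] (hπ : Continuous π)
    (h0 : ∀ i a, 0 ≤ w i a) (h1 : ∀ i a, w i a ≤ 1) (hw : ∀ i a b, w i a ≤ w i b + dist a b)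
    (hr : ∀ i x, 0 < w i (π x) → ContinuousAt (r i) x)
    (hbase : ∀ x, ∀ O ∈ 𝓝 x, ∃ i, 0 < w i (π x) ∧ ∃ W ∈ 𝓝 (π x), ∃ V ∈ 𝓝 (r i x),
      ∀ y, π y ∈ W → r i y ∈ V → y ∈ O) :
    (gluedPseudoMetric π r w h0 h1 hw).toUniformSpace.toTopologicalSpace = t := by
  have hwc : ∀ i, Continuous (w i) := fun i =>
    (LipschitzWith.of_le_add (hw i)).continuous
  refine TopologicalSpace.ext_nhds fun x => le_antisymm (fun O hO => ?_) ?_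
  · obtain ⟨i, hi, W, hW, V, hV, hO⟩ := hbase x O hO
    obtain ⟨ε, hε, hεW⟩ := Metric.mem_nhds_iff.1 hW
    obtain ⟨δ, hδ, hδV⟩ := Metric.mem_nhds_iff.1 hV
    have hc : (0 : ℝ) < (1 / 2) ^ Encodable.encode i := by positivity
    refine (@Metric.mem_nhds_iff X (gluedPseudoMetric π r w h0 h1 hw) x O).2
      ⟨min ε ((1 / 2) ^ Encodable.encode i * min δ (w i (π x))),
        lt_min hε (mul_pos hc (lt_min hδ hi)), fun y hy => ?_⟩
    have hd : gluedDist π r w x y < _ :=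
      (@Metric.mem_ball' X (gluedPseudoMetric π r w h0 h1 hw) x y _).1 hy
    have hs := (summable_gluedDist (π := π) (r := r) h0 h1 x y).le_tsum i
      (fun j _ => mul_nonneg (by positivity) (coneDist_nonneg (h0 j) x y))
    have hcone : coneDist π (r i) (w i) x y < min δ (w i (π x)) := by
      refine lt_of_mul_lt_mul_left (hs.trans_lt ?_) hc.le
      refine lt_of_le_of_lt ?_ (hd.trans_le (min_le_right _ _))
      exact le_add_of_nonneg_left dist_nonneg
    have hπy : dist (π x) (π y) < ε := by
      refine lt_of_le_of_lt ?_ (hd.trans_le (min_le_left _ _))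
      exact le_add_of_nonneg_right (tsum_nonneg fun j =>
        mul_nonneg (by positivity) (coneDist_nonneg (h0 j) x y))
    -- A cone distance below the weight of `x` cannot be realised through the cone point.
    have hfib : dist (π x) (π y) + dist (r i x) (r i y) < δ := by
      rcases min_lt_iff.1 hcone with h | h
      · exact h.trans_le (min_le_left _ _)
      · linarith [h.trans_le (min_le_right _ _), h0 i (π y)]
    refine hO y (hεW (by rwa [Metric.mem_ball'])) (hδV ?_)
    rw [Metric.mem_ball']
    linarith [@dist_nonneg _ _ (π x) (π y)]
  · refine (@Metric.nhds_basis_ball X (gluedPseudoMetric π r w h0 h1 hw) x).ge_iff.2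
      fun ε hε => ?_
    filter_upwards [(tendsto_gluedDist hπ h0 h1 hwc hr x).eventually (gt_mem_nhds hε)] with y hy
    exact (@Metric.mem_ball' X (gluedPseudoMetric π r w h0 h1 hw) x y _).2 hy

end GluedDist

theorem exists_metricSpace_of_pseudoMetric {X : Type*} [t : TopologicalSpace X] [T0Space X]
    (d : PseudoMetricSpace X) (hd : d.toUniformSpace.toTopologicalSpace = t) :
    ∃ m : MetricSpace X, m.toPseudoMetricSpace = d := by
  subst hd
  exact ⟨MetricSpace.ofT0PseudoMetricSpace X, rfl⟩

/-! ### Invariant pseudometrics on topological groups -/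

section InvariantMetric

/-- Taking the supremum of a truncated pseudometric along an equicontinuous family of self-maps
containing the identity gives a pseudometric for the same topology, which is not increased by any
map under which the family is closed by composition on the right. -/
theorem exists_pseudoMetric_nonexpanding {X ι : Type*} [t : TopologicalSpace X]
    (m : PseudoMetricSpace X) (hm : m.toUniformSpace.toTopologicalSpace = t) (f : ι → X → X)
    (i₀ : ι) (hi₀ : ∀ x, f i₀ x = x)
    (hequi : ∀ x, ∀ ε > 0, ∀ᶠ y in 𝓝 x, ∀ i, m.dist (f i x) (f i y) < ε) :
    ∃ m' : PseudoMetricSpace X, m'.toUniformSpace.toTopologicalSpace = t ∧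
      ∀ φ : X → X, (∀ i, ∃ j, ∀ x, f i (φ x) = f j x) →
        ∀ x y, m'.dist (φ x) (φ y) ≤ m'.dist x y := by
  subst hm
  have : Nonempty ι := ⟨i₀⟩
  have hbdd : ∀ x y, BddAbove (Set.range fun i => min 1 (dist (f i x) (f i y))) := fun x y =>
    ⟨1, by rintro _ ⟨i, rfl⟩; exact min_le_left _ _⟩
  have hle : ∀ x y i, min 1 (dist (f i x) (f i y)) ≤ ⨆ i, min 1 (dist (f i x) (f i y)) :=
    fun x y i => le_ciSup (hbdd x y) i
  let m' : PseudoMetricSpace X :=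
    { dist := fun x y => ⨆ i, min 1 (dist (f i x) (f i y))
      dist_self := fun x => by simp
      dist_comm := fun x y => by simp only [dist_comm]
      dist_triangle := fun x y z => by
        refine ciSup_le fun i => ?_
        have h1 := hle x y i
        have h2 := hle y z i
        have h3 := dist_triangle (f i x) (f i y) (f i z)
        have h4 := @dist_nonneg _ _ (f i x) (f i y)
        have h5 := @dist_nonneg _ _ (f i y) (f i z)
        refine le_trans ?_ (add_le_add h1 h2)
        rcases le_total 1 (dist (f i x) (f i y)) with h | h
        · rw [min_eq_left h]
          exact (min_le_left _ _).trans (le_add_of_nonneg_right (le_min zero_le_one h5))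
        rcases le_total 1 (dist (f i y) (f i z)) with h' | h'
        · rw [min_eq_left h']
          exact (min_le_left _ _).trans (le_add_of_nonneg_left (le_min zero_le_one h4))
        · rw [min_eq_right h, min_eq_right h']
          exact (min_le_right _ _).trans h3 }
  have hdist : ∀ x y, m'.dist x y = ⨆ i, min 1 (m.dist (f i x) (f i y)) := fun _ _ => rfl
  refine ⟨m', TopologicalSpace.ext_nhds fun x => le_antisymm ?_ ?_, fun φ hφ x y => ?_⟩
  · refine (@Metric.nhds_basis_ball X m x).ge_iff.2 fun ε hε => ?_
    refine (@Metric.mem_nhds_iff X m' x _).2 ⟨min 1 ε, lt_min one_pos hε, fun y hy => ?_⟩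
    have h : m'.dist x y < min 1 ε := (@Metric.mem_ball' X m' x y _).1 hy
    have h1 := (hle x y i₀).trans_lt h
    rw [hi₀, hi₀] at h1
    refine (@Metric.mem_ball' X m x y _).2 ?_
    rcases min_lt_iff.1 h1 with h2 | h2
    · exact absurd (h2.trans_le (min_le_left _ _)) (lt_irrefl _)
    · exact h2.trans_le (min_le_right _ _)
  · refine (@Metric.nhds_basis_ball X m' x).ge_iff.2 fun ε hε => ?_
    filter_upwards [hequi x (ε / 2) (half_pos hε)] with y hy
    refine (@Metric.mem_ball' X m' x y _).2 (lt_of_le_of_lt ?_ (half_lt_self hε))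
    exact ciSup_le fun i => (min_le_right _ _).trans (hy i).le
  · rw [hdist, hdist]
    refine ciSup_le fun i => ?_
    obtain ⟨j, hj⟩ := hφ i
    rw [hj, hj]
    exact hle x y j

theorem isBalancedGroup_of_biinvariant {G : Type*} [Group G] [t : TopologicalSpace G]
    (m : PseudoMetricSpace G) (hm : m.toUniformSpace.toTopologicalSpace = t)
    (hl : ∀ g x y : G, m.dist (g * x) (g * y) ≤ m.dist x y)
    (hr : ∀ g x y : G, m.dist (x * g) (y * g) ≤ m.dist x y) : IsBalancedGroup G := by
  subst hm
  intro U hU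
  obtain ⟨ε, hε, hεU⟩ := Metric.mem_nhds_iff.1 hU
  have hconj : ∀ g v : G, v ∈ Metric.ball (1 : G) ε → g * v * g⁻¹ ∈ Metric.ball (1 : G) ε := by
    intro g v hv
    have h := (hr g⁻¹ (g * v) (g * 1)).trans (hl g v 1)
    rw [mul_one, mul_inv_cancel] at h
    exact lt_of_le_of_lt h hv
  refine ⟨Metric.ball 1 ε, Metric.ball_mem_nhds _ hε, hεU, fun g => Set.Subset.antisymm ?_ ?_⟩
  · rintro _ ⟨v, hv, rfl⟩
    exact hconj g v hv
  · intro v hv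
    exact ⟨g⁻¹ * v * g, by simpa using hconj g⁻¹ v hv, by simp [mul_assoc]⟩

theorem dist_inv_inv_le_of_biinvariant {G : Type*} [Group G] (m : PseudoMetricSpace G)
    (hl : ∀ g x y : G, m.dist (g * x) (g * y) ≤ m.dist x y)
    (hr : ∀ g x y : G, m.dist (x * g) (y * g) ≤ m.dist x y) (x y : G) :
    m.dist x⁻¹ y⁻¹ ≤ m.dist x y := by
  have h1 := hl x⁻¹ 1 (x * y⁻¹)
  have h2 := hr y⁻¹ y x
  rw [mul_one, inv_mul_cancel_left] at h1
  rw [mul_inv_cancel, m.dist_comm y x] at h2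
  exact h1.trans h2

theorem eventually_inv_mul_mem {G : Type*} [Group G] [TopologicalSpace G]
    [IsTopologicalGroup G] (x : G) {V : Set G} (hV : V ∈ 𝓝 (1 : G)) :
    ∀ᶠ y in 𝓝 x, x⁻¹ * y ∈ V := by
  have h : Filter.Tendsto (fun y => x⁻¹ * y) (𝓝 x) (𝓝 (x⁻¹ * x)) :=
    (continuous_const.mul continuous_id).continuousAt
  rw [inv_mul_cancel] at h
  exact h hV

variable {G : Type*} [Group G] [t : TopologicalSpace G] [IsTopologicalGroup G]
  [FirstCountableTopology G]

/-- A first countable topological group carries a compatible pseudometric whose small distances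
are controlled by the left uniformity: `x` and `y` are close as soon as `x⁻¹ * y` is close
to `1`. -/
theorem exists_pseudoMetric_leftUniform :
    ∃ m : PseudoMetricSpace G, m.toUniformSpace.toTopologicalSpace = t ∧
      ∀ ε > 0, ∃ V ∈ 𝓝 (1 : G), ∀ x y, x⁻¹ * y ∈ V → m.dist x y < ε := by
  let u : UniformSpace G := IsTopologicalGroup.leftUniformSpace G
  have : (uniformity G).IsCountablyGenerated := by
    change (Filter.comap (fun p : G × G => p.1⁻¹ * p.2) (𝓝 1)).IsCountablyGenerated
    infer_instance
  obtain ⟨m, hm⟩ := UniformSpace.metrizable_uniformity G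
  refine ⟨m, by rw [hm]; rfl, fun ε hε => ?_⟩
  have h := @Metric.dist_mem_uniformity G m ε hε
  rw [hm] at h
  obtain ⟨V, hV, hVs⟩ := Filter.mem_comap.1 h
  exact ⟨V, hV, fun x y hxy => @hVs (x, y) hxy⟩

/-- The Birkhoff–Kakutani theorem: a first countable group has a left invariant pseudometric. -/
theorem exists_pseudoMetric_leftInvariant :
    ∃ m : PseudoMetricSpace G, m.toUniformSpace.toTopologicalSpace = t ∧
      ∀ g x y : G, m.dist (g * x) (g * y) ≤ m.dist x y := by
  obtain ⟨m, hm, hV⟩ := exists_pseudoMetric_leftUniform (G := G)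
  obtain ⟨m', hm', hinv⟩ := exists_pseudoMetric_nonexpanding m hm (fun g x : G => g * x) 1
    one_mul fun x ε hε => by
      obtain ⟨V, hV1, hV⟩ := hV ε hε
      filter_upwards [eventually_inv_mul_mem x hV1] with y hy g
      exact hV _ _ (by simpa [mul_assoc] using hy)
  exact ⟨m', hm', fun g => hinv _ fun h => ⟨h * g, fun x => (mul_assoc _ _ _).symm⟩⟩

/-- A first countable balanced group has a two-sided invariant pseudometric: conjugation invariant
neighbourhoods of `1` make the two-sided translations equicontinuous. -/
theorem exists_pseudoMetric_biinvariant (hG : IsBalancedGroup G) :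
    ∃ m : PseudoMetricSpace G, m.toUniformSpace.toTopologicalSpace = t ∧
      (∀ g x y : G, m.dist (g * x) (g * y) ≤ m.dist x y) ∧
      ∀ g x y : G, m.dist (x * g) (y * g) ≤ m.dist x y := by
  obtain ⟨m, hm, hV⟩ := exists_pseudoMetric_leftUniform (G := G)
  obtain ⟨m', hm', hinv⟩ := exists_pseudoMetric_nonexpanding m hm
    (fun (p : G × G) x => p.1 * x * p.2) (1, 1) (fun x => by simp) fun x ε hε => by
      obtain ⟨V, hV1, hV⟩ := hV ε hε
      obtain ⟨V', hV1', hVV', hconj⟩ := hG V hV1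
      filter_upwards [eventually_inv_mul_mem x hV1'] with y hy p
      refine hV _ _ (hVV' ?_)
      rw [← hconj p.2⁻¹]
      exact ⟨_, hy, by simp [mul_assoc]⟩
  exact ⟨m', hm',
    fun g => hinv _ fun p => ⟨(p.1 * g, p.2), fun x => by simp [mul_assoc]⟩,
    fun g => hinv _ fun p => ⟨(p.1, g * p.2), fun x => by simp [mul_assoc]⟩⟩

end InvariantMetric

/-! ### Central idempotents of a Clifford semigroup -/

namespace CliffordSemigroup

section Algebra

variable {S : Type*} [CliffordSemigroup S]

theorem inv_inv_eq (x : S) : x⁻¹⁻¹ = x :=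
  (eq_inv_of_mul _ _ (inv_mul_inv_self x) (mul_inv_mul_self x)).symm

theorem idem_comm {e f : S} (he : e * e = e) (hf : f * f = f) : e * f = f * e := by
  have hef := idem_mul he hf
  have hfe := idem_mul hf he
  -- Both `e * f` and `f * e` are inverse to the idempotent `e * f`.
  have h : f * e = (e * f)⁻¹ := by
    apply eq_inv_of_mul
    · calc e * f * (f * e) * (e * f) = e * (f * f) * (e * e) * f := by simp only [mul_assoc]
        _ = e * f * (e * f) := by rw [he, hf]; simp only [mul_assoc]
        _ = e * f := hef
    · calc f * e * (e * f) * (f * e) = f * (e * e) * (f * f) * e := by simp only [mul_assoc]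
        _ = f * e * (f * e) := by rw [he, hf]; simp only [mul_assoc]
        _ = f * e := hfe
  rw [h, inv_eq_of_idem hef]

theorem mul_inv_rev' (x y : S) : (x * y)⁻¹ = y⁻¹ * x⁻¹ := by
  have hx : (x⁻¹ * x) * (x⁻¹ * x) = x⁻¹ * x := by rw [← mul_assoc, inv_mul_inv_self]
  have hc := idem_comm (mul_inv_idem y) hx
  symm
  apply eq_inv_of_mul
  · calc x * y * (y⁻¹ * x⁻¹) * (x * y) = x * ((y * y⁻¹) * (x⁻¹ * x)) * y := by
          simp only [mul_assoc]
      _ = (x * x⁻¹ * x) * (y * y⁻¹ * y) := by rw [hc]; simp only [mul_assoc]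
      _ = x * y := by rw [mul_inv_mul_self, mul_inv_mul_self]
  · calc y⁻¹ * x⁻¹ * (x * y) * (y⁻¹ * x⁻¹) = y⁻¹ * ((x⁻¹ * x) * (y * y⁻¹)) * x⁻¹ := by
          simp only [mul_assoc]
      _ = (y⁻¹ * y * y⁻¹) * (x⁻¹ * x * x⁻¹) := by rw [← hc]; simp only [mul_assoc]
      _ = y⁻¹ * x⁻¹ := by rw [inv_mul_inv_self, inv_mul_inv_self]

/-- Idempotents of a Clifford semigroup are central. -/
theorem idem_central {e : S} (he : e * e = e) (x : S) : e * x = x * e := by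
  -- Comparing `(e * y) * (e * y)⁻¹` with `(e * y)⁻¹ * (e * y)`.
  have key : ∀ y : S, e * (y * y⁻¹) = y⁻¹ * e * y := fun y => by
    have h := mul_inv_comm (e * y)
    rw [mul_inv_rev', inv_eq_of_idem he] at h
    calc e * (y * y⁻¹) = e * e * (y * y⁻¹) := by rw [he]
      _ = e * (y * y⁻¹ * e) := by rw [mul_assoc, idem_comm he (mul_inv_idem y)]
      _ = e * y * (y⁻¹ * e) := by simp only [mul_assoc]
      _ = y⁻¹ * e * (e * y) := h
      _ = y⁻¹ * (e * e) * y := by simp only [mul_assoc]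
      _ = y⁻¹ * e * y := by rw [he]
  have h := key x⁻¹
  rw [inv_inv_eq, ← mul_inv_comm] at h
  calc e * x = e * (x * x⁻¹) * x := by rw [mul_assoc, mul_inv_mul_self]
    _ = x * e * (x⁻¹ * x) := by rw [h, mul_assoc]
    _ = x * (x⁻¹ * x * e) := by
      rw [← mul_inv_comm, mul_assoc, idem_comm he (mul_inv_idem x)]
    _ = x * x⁻¹ * x * e := by simp only [mul_assoc]
    _ = x * e := by rw [mul_inv_mul_self]

end Algebra
end CliffordSemigroup

/-! ### Translation into the maximal subgroups -/

namespace CliffordSemigroup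

section Algebra

variable {S : Type*} [CliffordSemigroup S]

theorem proj_mul (x y : S) : proj (x * y) = proj x * proj y := by
  apply Subtype.ext
  change x * y * (x * y)⁻¹ = x * x⁻¹ * (y * y⁻¹)
  rw [mul_inv_rev', mul_assoc x x⁻¹, ← idem_central (mul_inv_idem y)]
  simp only [mul_assoc]

theorem proj_coe (e : maximalSemilattice S) : proj (e : S) = e := by
  have he : (e : S) * e = e := e.2
  apply Subtype.ext
  change (e : S) * (e : S)⁻¹ = e
  rw [inv_eq_of_idem he, he]

theorem proj_inv (x : S) : proj x⁻¹ = proj x := by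
  apply Subtype.ext
  change x⁻¹ * x⁻¹⁻¹ = x * x⁻¹
  rw [inv_inv_eq, mul_inv_comm]

theorem mul_proj (x : S) : x * (proj x : S) = x := by
  change x * (x * x⁻¹) = x
  rw [mul_inv_comm, ← mul_assoc, mul_inv_mul_self]

theorem maximalSemilattice_mul_comm (e f : maximalSemilattice S) : e * f = f * e :=
  Subtype.ext (idem_comm e.2 f.2)

theorem mem_upperCone_iff {e f : maximalSemilattice S} : f ∈ upperCone e ↔ e * f = e :=
  ⟨fun h => h.1, fun h => ⟨h, (maximalSemilattice_mul_comm f e).trans h⟩⟩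

theorem mem_maximalSubgroup_iff {e : maximalSemilattice S} {x : S} :
    x ∈ maximalSubgroup e ↔ proj x = e :=
  ⟨fun h => Subtype.ext h.1, fun h => h ▸ ⟨rfl, (mul_inv_comm x).symm⟩⟩

theorem right_mem_upperCone_of_mul {e f g : maximalSemilattice S} (h : f * g ∈ upperCone e) :
    g ∈ upperCone e := by
  rw [mem_upperCone_iff] at h ⊢
  have hg : g * g = g := Subtype.ext g.2
  calc e * g = e * (f * g) * g := by rw [h]
    _ = e * (f * (g * g)) := by simp only [mul_assoc]
    _ = e := by rw [hg, h]

theorem left_mem_upperCone_of_mul {e f g : maximalSemilattice S} (h : f * g ∈ upperCone e) :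
    f ∈ upperCone e :=
  right_mem_upperCone_of_mul (maximalSemilattice_mul_comm f g ▸ h)

theorem mul_mem_maximalSubgroup {e : maximalSemilattice S} {x : S} (h : proj x ∈ upperCone e) :
    x * (e : S) ∈ maximalSubgroup e := by
  rw [mem_maximalSubgroup_iff, proj_mul, proj_coe]
  exact h.2

open Classical in
/-- The translation `x ↦ x * e` into the maximal subgroup `H_e`, defined for `e ≤ π x` and given
the value `1` elsewhere. -/
noncomputable def toMaximalSubgroup (e : maximalSemilattice S) (x : S) : maximalSubgroup e :=
  if h : proj x ∈ upperCone e then ⟨x * e, mul_mem_maximalSubgroup h⟩ else 1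

theorem coe_toMaximalSubgroup {e : maximalSemilattice S} {x : S} (h : proj x ∈ upperCone e) :
    (toMaximalSubgroup e x : S) = x * e := by
  rw [toMaximalSubgroup, dif_pos h]

theorem toMaximalSubgroup_mul {e : maximalSemilattice S} {x y : S}
    (h : proj (x * y) ∈ upperCone e) :
    toMaximalSubgroup e (x * y) = toMaximalSubgroup e x * toMaximalSubgroup e y := by
  have h' := h
  rw [proj_mul] at h'
  apply Subtype.ext
  change _ = (toMaximalSubgroup e x : S) * (toMaximalSubgroup e y : S)
  rw [coe_toMaximalSubgroup h, coe_toMaximalSubgroup (left_mem_upperCone_of_mul h'),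
    coe_toMaximalSubgroup (right_mem_upperCone_of_mul h')]
  have he : (e : S) * e = e := e.2
  calc x * y * (e : S) = x * y * (e * e) := by rw [he]
    _ = x * (y * e) * e := by simp only [mul_assoc]
    _ = x * e * (y * e) := by rw [← idem_central he y]; simp only [mul_assoc]; rw [idem_central he y]

theorem toMaximalSubgroup_inv {e : maximalSemilattice S} {x : S} (h : proj x ∈ upperCone e) :
    toMaximalSubgroup e x⁻¹ = (toMaximalSubgroup e x)⁻¹ := by
  apply Subtype.ext
  change _ = (toMaximalSubgroup e x : S)⁻¹
  rw [coe_toMaximalSubgroup ((proj_inv x).symm ▸ h), coe_toMaximalSubgroup h, mul_inv_rev',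
    inv_eq_of_idem e.2, idem_central e.2]

end Algebra

/-! ### The topology of a ditopological Clifford semigroup -/

section Topology

variable {S : Type*} [CliffordSemigroup S] [t : TopologicalSpace S] [ContinuousMul S]

instance (e : maximalSemilattice S) [ContinuousInv S] : IsTopologicalGroup (maximalSubgroup e) where
  continuous_mul := Continuous.subtype_mk
    ((continuous_subtype_val.comp continuous_fst).mul (continuous_subtype_val.comp continuous_snd)) _
  continuous_inv := Continuous.subtype_mk continuous_subtype_val.inv _

theorem continuous_proj [ContinuousInv S] : Continuous (proj : S → maximalSemilattice S) :=
  (continuous_id.mul continuous_inv).subtype_mk _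

theorem right_mem_interior_upperCone_of_mul {e f g : maximalSemilattice S}
    (h : f * g ∈ interior (upperCone e)) : g ∈ interior (upperCone e) := by
  have hc : Continuous fun k : maximalSemilattice S => f * k := continuous_const.mul continuous_id
  exact interior_maximal (fun k hk => right_mem_upperCone_of_mul (interior_subset hk))
    (isOpen_interior.preimage hc) h

theorem continuousAt_toMaximalSubgroup [ContinuousInv S] {e : maximalSemilattice S} {x : S}
    (h : WayBelow e (proj x)) : ContinuousAt (toMaximalSubgroup e) x := by
  rw [IsInducing.subtypeVal.continuousAt_iff]
  have hc : ContinuousAt (fun y : S => y * (e : S)) x :=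
    (continuous_id.mul continuous_const).continuousAt
  refine hc.congr ?_
  filter_upwards [continuous_proj.continuousAt (isOpen_interior.mem_nhds h)] with y hy
  exact (coe_toMaximalSubgroup (interior_subset hy)).symm

/-- In a ditopological semigroup with a `U`-dense set `A` of idempotents, a neighbourhood of `x` is
controlled by `π` and by the translation into a single group `H_e` with `e ∈ A`. -/
theorem exists_nhds_of_isDitopological [ContinuousInv S] (hS : IsDitopological S)
    {A : Set (maximalSemilattice S)} (hA : IsUDense A) (x : S) {O : Set S} (hO : O ∈ 𝓝 x) :
    ∃ e : A, WayBelow (e : maximalSemilattice S) (proj x) ∧ ∃ W ∈ 𝓝 (proj x),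
      ∃ V ∈ 𝓝 (toMaximalSubgroup (e : maximalSemilattice S) x),
        ∀ y, proj y ∈ W → toMaximalSubgroup (e : maximalSemilattice S) y ∈ V → y ∈ O := by
  obtain ⟨U, hU, W, hW, hUW⟩ := hS x O hO
  -- Since `x * π x = x`, translations of `x` by idempotents close to `π x` stay in `U`.
  have hc : Filter.Tendsto (fun f : maximalSemilattice S => x * (f : S)) (𝓝 (proj x)) (𝓝 x) := by
    have h : ContinuousAt (fun f : maximalSemilattice S => x * (f : S)) (proj x) :=
      (continuous_const.mul continuous_subtype_val).continuousAt
    rwa [ContinuousAt, mul_proj] at h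
  obtain ⟨e, ⟨⟨heW, heU⟩, heA⟩, hex⟩ := hA (proj x) _
    (Filter.inter_mem hW (hc (interior_mem_nhds.2 hU)))
  have hx := coe_toMaximalSubgroup (interior_subset hex)
  refine ⟨⟨e, heA⟩, hex, W ∩ interior (upperCone e),
    Filter.inter_mem hW (isOpen_interior.mem_nhds hex), Subtype.val ⁻¹' interior U, ?_,
    fun y hy hyU => hUW ⟨?_, hy.1⟩⟩
  · refine (isOpen_interior.preimage continuous_subtype_val).mem_nhds ?_
    change (toMaximalSubgroup e x : S) ∈ interior U
    rw [hx]
    exact heU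
  · have hyU' : (toMaximalSubgroup e y : S) ∈ interior U := hyU
    exact ⟨_, interior_subset hyU', e, ⟨e, heW, rfl⟩,
      coe_toMaximalSubgroup (interior_subset hy.2)⟩

/-- A metric on `E` and metrics on the groups `H_e`, `e ∈ A`, glue to a metric on `S`. A self-map
`φ` of `S` is nonexpanding for it if it covers a nonexpanding map `ψ` of `E` and is nonexpanding
on the groups `H_e`. -/
theorem exists_metricSpace_of_maximalSemilattice [T0Space S] [ContinuousInv S]
    (hS : IsDitopological S)
    {A : Set (maximalSemilattice S)} (hAc : A.Countable) (hA : IsUDense A)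
    (m : PseudoMetricSpace (maximalSemilattice S))
    (hm : m.toUniformSpace.toTopologicalSpace = instTopologicalSpaceSubtype)
    (ρ : ∀ e : A, PseudoMetricSpace (maximalSubgroup (e : maximalSemilattice S)))
    (hρ : ∀ e, (ρ e).toUniformSpace.toTopologicalSpace = instTopologicalSpaceSubtype) :
    ∃ d : MetricSpace S, d.toUniformSpace.toTopologicalSpace = t ∧
      ∀ (φ : S → S) (ψ : maximalSemilattice S → maximalSemilattice S),
        (∀ x, proj (φ x) = ψ (proj x)) → (∀ a b, m.dist (ψ a) (ψ b) ≤ m.dist a b) →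
        (∀ e a : maximalSemilattice S, WayBelow e (ψ a) → WayBelow e a) →
        (∀ (e : A) (x y : S), WayBelow (e : maximalSemilattice S) (proj (φ x)) →
          WayBelow (e : maximalSemilattice S) (proj (φ y)) →
          (ρ e).dist (toMaximalSubgroup e (φ x)) (toMaximalSubgroup e (φ y)) ≤
            (ρ e).dist (toMaximalSubgroup e x) (toMaximalSubgroup e y)) →
        ∀ x y, d.dist (φ x) (φ y) ≤ d.dist x y := by
  have : Countable A := hAc.to_subtype
  have := Encodable.ofCountable A
  let mE : PseudoMetricSpace (maximalSemilattice S) := m.replaceTopology hm.symm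
  let mH : ∀ e : A, PseudoMetricSpace (maximalSubgroup (e : maximalSemilattice S)) :=
    fun e => (ρ e).replaceTopology (hρ e).symm
  let T : A → Set (maximalSemilattice S) := fun e => interior (upperCone (e : maximalSemilattice S))
  let w : A → maximalSemilattice S → ℝ := fun e => cappedInfDist (T e)ᶜ
  have hw_pos : ∀ e a, 0 < w e a ↔ WayBelow (e : maximalSemilattice S) a := fun e a =>
    cappedInfDist_compl_pos_iff isOpen_interior
  have h0 : ∀ e a, 0 ≤ w e a := fun e => cappedInfDist_nonneg _
  have h1 : ∀ e a, w e a ≤ 1 := fun e => cappedInfDist_le_one _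
  have hw : ∀ e a b, w e a ≤ w e b + dist a b := fun e => cappedInfDist_le_add _
  let r : ∀ e : A, S → maximalSubgroup (e : maximalSemilattice S) := fun e =>
    toMaximalSubgroup (e : maximalSemilattice S)
  have htop := gluedPseudoMetric_toTopologicalSpace (X := S) (π := proj) (r := r)
    continuous_proj h0 h1 hw
    (fun e x hx => continuousAt_toMaximalSubgroup ((hw_pos e _).1 hx))
    (fun x O hO => by
      obtain ⟨e, he, h⟩ := exists_nhds_of_isDitopological hS hA x hO
      exact ⟨e, (hw_pos e _).2 he, h⟩)
  obtain ⟨d, hd⟩ := exists_metricSpace_of_pseudoMetric _ htop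
  refine ⟨d, by rw [hd]; exact htop, fun φ ψ hφψ hψ hψT hφ x y => ?_⟩
  have key := gluedDist_map_le (π := proj) (r := r) h0 h1 hw (φ := φ)
    (fun x y => by rw [hφψ, hφψ]; exact hψ _ _)
    (fun e x => by
      rw [hφψ]
      exact cappedInfDist_map_le hψ (fun a (ha : a ∉ T e) h => ha (hψT _ _ h)) _)
    (fun e x y hx hy => hφ e x y ((hw_pos e _).1 hx) ((hw_pos e _).1 hy)) x y
  have hdist : ∀ x y, d.dist x y = gluedDist proj r w x y := fun x y => by
    rw [hd]
    rfl
  rw [hdist, hdist]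
  exact key

end Topology

end CliffordSemigroup

/-! ### Metrizability -/

theorem SubinvariantMetrizable.leftSubinvariantMetrizable {S : Type*} [CliffordSemigroup S]
    [TopologicalSpace S] (h : SubinvariantMetrizable S) : LeftSubinvariantMetrizable S := by
  obtain ⟨m, hm, h⟩ := h
  exact ⟨m, hm, fun x y z => (le_max_left _ _).trans (h x y z).1⟩

section Restriction

open CliffordSemigroup

variable {S : Type*} [CliffordSemigroup S] [t : TopologicalSpace S]

theorem LeftSubinvariantMetrizable.metrizableSpace (h : LeftSubinvariantMetrizable S) :
    TopologicalSpace.MetrizableSpace S := by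
  obtain ⟨m, rfl, -⟩ := h
  infer_instance

theorem LeftSubinvariantMetrizable.maximalSemilattice (h : LeftSubinvariantMetrizable S) :
    SubinvariantMetrizable (maximalSemilattice S) := by
  obtain ⟨m, rfl, h⟩ := h
  refine ⟨MetricSpace.induced Subtype.val Subtype.val_injective m, rfl, fun x y z => ⟨?_, ?_⟩⟩
  · refine max_le (h x y z) ?_
    rw [maximalSemilattice_mul_comm x, maximalSemilattice_mul_comm y]
    exact h x y z
  · have hinv : ∀ e : CliffordSemigroup.maximalSemilattice S, e⁻¹ = e := fun e =>
      Subtype.ext (inv_eq_of_idem e.2)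
    rw [hinv, hinv]

theorem SubinvariantMetrizable.isBalancedGroup_maximalSubgroup (h : SubinvariantMetrizable S)
    (e : maximalSemilattice S) : IsBalancedGroup (maximalSubgroup e) := by
  obtain ⟨m, rfl, h⟩ := h
  exact isBalancedGroup_of_biinvariant
    (MetricSpace.induced Subtype.val Subtype.val_injective m).toPseudoMetricSpace rfl
    (fun g x y => (le_max_left _ _).trans (h x y g).1)
    (fun g x y => (le_max_right _ _).trans (h x y g).1)

theorem metrizableSpace_maximalSemilattice [TopologicalSpace.MetrizableSpace S] :
    TopologicalSpace.MetrizableSpace (maximalSemilattice S) :=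
  IsEmbedding.subtypeVal.metrizableSpace

theorem firstCountableTopology_maximalSubgroup [TopologicalSpace.MetrizableSpace S]
    (e : maximalSemilattice S) : FirstCountableTopology (maximalSubgroup e) :=
  have : FirstCountableTopology S := inferInstance
  IsInducing.subtypeVal.firstCountableTopology

variable [T2Space S] [ContinuousMul S] [ContinuousInv S]

theorem metrizableSpace_of_maximalSubgroups (hS : IsDitopological S)
    {A : Set (maximalSemilattice S)} (hAc : A.Countable) (hA : IsUDense A)
    (hE : TopologicalSpace.MetrizableSpace (maximalSemilattice S))
    (hH : ∀ e ∈ A, FirstCountableTopology (maximalSubgroup e)) :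
    TopologicalSpace.MetrizableSpace S := by
  choose ρ hρ _ using fun e : A =>
    have := hH e e.2
    exists_pseudoMetric_leftInvariant (G := maximalSubgroup (e : maximalSemilattice S))
  obtain ⟨d, rfl, -⟩ := exists_metricSpace_of_maximalSemilattice hS hAc hA
    (TopologicalSpace.metrizableSpaceMetric (maximalSemilattice S)).toPseudoMetricSpace rfl ρ hρ
  infer_instance

theorem leftSubinvariantMetrizable_of_maximalSubgroups (hS : IsDitopological S)
    {A : Set (maximalSemilattice S)} (hAc : A.Countable) (hA : IsUDense A)
    (hE : SubinvariantMetrizable (maximalSemilattice S))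
    (hH : ∀ e ∈ A, FirstCountableTopology (maximalSubgroup e)) :
    LeftSubinvariantMetrizable S := by
  obtain ⟨m, hm, hsub⟩ := hE
  choose ρ hρ hl using fun e : A =>
    have := hH e e.2
    exists_pseudoMetric_leftInvariant (G := maximalSubgroup (e : maximalSemilattice S))
  obtain ⟨d, hd, hmap⟩ := exists_metricSpace_of_maximalSemilattice hS hAc hA
    m.toPseudoMetricSpace hm ρ hρ
  refine ⟨d, hd, fun x y z => hmap (z * ·) (proj z * ·) (proj_mul z)
    (fun a b => (le_max_left _ _).trans (hsub a b _).1)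
    (fun e a h => right_mem_interior_upperCone_of_mul h) (fun e x y hx hy => ?_) x y⟩
  rw [toMaximalSubgroup_mul (interior_subset hx), toMaximalSubgroup_mul (interior_subset hy)]
  exact hl e _ _ _

theorem subinvariantMetrizable_of_maximalSubgroups (hS : IsDitopological S)
    {A : Set (maximalSemilattice S)} (hAc : A.Countable) (hA : IsUDense A)
    (hE : SubinvariantMetrizable (maximalSemilattice S))
    (hH : ∀ e ∈ A, FirstCountableTopology (maximalSubgroup e) ∧
      IsBalancedGroup (maximalSubgroup e)) :
    SubinvariantMetrizable S := by
  obtain ⟨m, hm, hsub⟩ := hE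
  choose ρ hρ hl hr using fun e : A =>
    have := (hH e e.2).1
    exists_pseudoMetric_biinvariant (hH e e.2).2
  obtain ⟨d, hd, hmap⟩ := exists_metricSpace_of_maximalSemilattice hS hAc hA
    m.toPseudoMetricSpace hm ρ hρ
  have hinv : ∀ x y, d.dist x⁻¹ y⁻¹ ≤ d.dist x y :=
    hmap (·⁻¹) id proj_inv (fun _ _ => le_rfl) (fun _ _ h => h) fun e x y hx hy => by
      rw [proj_inv] at hx hy
      rw [toMaximalSubgroup_inv (interior_subset hx), toMaximalSubgroup_inv (interior_subset hy)]
      exact dist_inv_inv_le_of_biinvariant _ (hl e) (hr e) _ _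
  refine ⟨d, hd, fun x y z => ⟨max_le ?_ ?_, le_antisymm ?_ (hinv x y)⟩⟩
  · refine hmap (z * ·) (proj z * ·) (proj_mul z)
      (fun a b => (le_max_left _ _).trans (hsub a b _).1)
      (fun e a h => right_mem_interior_upperCone_of_mul h) (fun e x y hx hy => ?_) x y
    rw [toMaximalSubgroup_mul (interior_subset hx), toMaximalSubgroup_mul (interior_subset hy)]
    exact hl e _ _ _
  · refine hmap (· * z) (· * proj z) (fun x => proj_mul x z)
      (fun a b => (le_max_right _ _).trans (hsub a b _).1)
      (fun e a h => right_mem_interior_upperCone_of_mul (f := proj z)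
        (by rw [maximalSemilattice_mul_comm]; exact h)) (fun e x y hx hy => ?_) x y
    rw [toMaximalSubgroup_mul (interior_subset hx), toMaximalSubgroup_mul (interior_subset hy)]
    exact hr e _ _ _
  · simpa only [inv_inv_eq] using hinv x⁻¹ y⁻¹

end Restriction

theorem mainTheorem4 {S : Type*} [CliffordSemigroup S] [TopologicalSpace S] [T2Space S]
    [ContinuousMul S] [ContinuousInv S]
    (hU : IsUSemilattice (CliffordSemigroup.maximalSemilattice S))
    (hS : IsDitopological S)
    (A : Set (CliffordSemigroup.maximalSemilattice S)) (hAcount : A.Countable)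
    (hA : IsUDense A) :
    (TopologicalSpace.MetrizableSpace S ↔
      TopologicalSpace.MetrizableSpace (CliffordSemigroup.maximalSemilattice S) ∧
        ∀ e ∈ A, FirstCountableTopology (CliffordSemigroup.maximalSubgroup e)) ∧
    (LeftSubinvariantMetrizable S ↔
      SubinvariantMetrizable (CliffordSemigroup.maximalSemilattice S) ∧
        ∀ e ∈ A, FirstCountableTopology (CliffordSemigroup.maximalSubgroup e)) ∧
    (SubinvariantMetrizable S ↔
      SubinvariantMetrizable (CliffordSemigroup.maximalSemilattice S) ∧
        ∀ e ∈ A, FirstCountableTopology (CliffordSemigroup.maximalSubgroup e) ∧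
          IsBalancedGroup (CliffordSemigroup.maximalSubgroup e)) := by
  refine ⟨⟨fun h => ⟨metrizableSpace_maximalSemilattice,
      fun e _ => firstCountableTopology_maximalSubgroup e⟩,
      fun h => metrizableSpace_of_maximalSubgroups hS hAcount hA h.1 h.2⟩,
    ⟨fun h => ?_, fun h => leftSubinvariantMetrizable_of_maximalSubgroups hS hAcount hA h.1 h.2⟩,
    ⟨fun h => ?_, fun h => subinvariantMetrizable_of_maximalSubgroups hS hAcount hA h.1 h.2⟩⟩
  · have := h.metrizableSpace
    exact ⟨h.maximalSemilattice, fun e _ => firstCountableTopology_maximalSubgroup e⟩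
  · have := h.leftSubinvariantMetrizable.metrizableSpace
    exact ⟨h.leftSubinvariantMetrizable.maximalSemilattice, fun e _ =>
      ⟨firstCountableTopology_maximalSubgroup e, h.isBalancedGroup_maximalSubgroup e⟩⟩
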